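/- Let $m\ge 1$, let $a_1,\dots,a_{2m}$ be positive integers, and let $\frac rs=[a_1,\dots,a_{2m}]=a_1+\cfrac{1}{a_2+\cfrac{1}{\ddots+\cfrac1{a_{2m}}}}$. For a parameter $t$ put $[a]_t=1+t+\dots+t^{a-1}$. The $q$-rational $\left[\frac rs\right]_q\in\mathbb Z(q)$ is $$\left[\frac rs\right]_q=[a_1]_q+\cfrac{q^{a_1}}{[a_2]_{q^{-1}}+\cfrac{q^{-a_2}}{[a_3]_q+\cfrac{q^{a_3}}{[a_4]_{q^{-1}}+\cfrac{q^{-a_4}}{\ddots+\cfrac{q^{a_{2m-1}}}{[a_{2m}]_{q^{-1}}}}}}},$$ and we write it in lowest terms as $\left[\frac rs\right]_q=\frac{\mathcal R(q)}{\mathcal S(q)}$, with $\mathcal R,\mathcal S\in\mathbb Z[q]$ coprime and the leading coefficient of $\mathcal S$ positive. Let $G=G(r/s)$ be the snake graph of unit square tiles in which the step from each tile to the next goes right ($R$) or up ($U$) according to the word $R^{a_1-1}U^{a_2}R^{a_3}U^{a_4}\cdots R^{a_{2m-1}}U^{a_{2m}-1}$. Place $G$ so that the top left corner of its bounding box is the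 top left corner of Young diagrams (drawn with left-aligned rows, the longest row on top). Let $\lambda=\lambda(r/s)$ be the partition whose Young diagram has the same bottom boundary as $G$, so that $G$ is the set of boxes of $\lambda$ adjacent to its bottom boundary (along an edge or at a corner), and let $\mu=\mu(r/s)$ be the partition such that $G$ is the skew Young diagram $\lambda/\mu$. Partitions are ordered by inclusion of Young diagrams, and $|\mu|$ is the number of boxes of $\mu$. Let $n=\sum_{i=1}^{2m}a_i$ and $k=\sum_{i=1}^{m}a_{2i}$, and let $\mathrm{Gr}_k(n)$ be the set of $k$-dimensional subspaces of $\mathbb F_q^n$. For a partition $\nu=(\nu_1\ge\dots\ge\nu_k\ge 0)$ inside the $k\times(n-k)$ rectangle, let $I_\nu=\{\,i+(n-k)-\nu_i : 1\le i\le k\,\}$, the set of labels of the vertical steps when the bottom boundary of $\nu$ is walked from the top right to the bottom left corner of the rectangle and its steps are labelled $1,\dots,n$. The open Schubert cell $\Omega^\circ_\nu\subseteq\mathrm{Gr}_k(n)$ is the set of subspaces that are the row space of a $k\times n$ matrix in reduced row echelon form with pivot columns $I_\nu$. Then for every finite field $\mathbb F_q$ with $q$ elements, $$q^{|\mu|}\cdot\mathcal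 R(q)=\left|\bigcup_{\mu\le\nu\le\lambda}\Omega^\circ_\nu\right|.$$ -/

import Mathlib

namespace QSnake

/-! ### Continued fractions and their `q`-deformation -/

/-- The value of the finite continued fraction `[a₁, …, aₗ] = a₁ + 1 / (a₂ + 1 / (⋯ + 1 / aₗ))`. -/
def contFracValue : List ℕ → ℚ
  | [] => 0
  | [a] => a
  | a :: b :: l => a + 1 / contFracValue (b :: l)

/-- The `t`-integer `[a]_t = 1 + t + ⋯ + t ^ (a - 1)`. -/
def qInt {F : Type*} [Field F] (t : F) (a : ℕ) : F :=
  ∑ i ∈ Finset.range a, t ^ i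

/-- The `t`-deformed continued fraction
`[a₁]_t + t^a₁ / ([a₂]_{t⁻¹} + t^(-a₂) / ([a₃]_t + t^a₃ / ([a₄]_{t⁻¹} + ⋯)))`:
the parameter alternates between `t` and `t⁻¹`. -/
def qContFrac {F : Type*} [Field F] : F → List ℕ → F
  | _, [] => 0
  | t, [a] => qInt t a
  | t, a :: b :: l => qInt t a + t ^ a / qContFrac t⁻¹ (b :: l)

/-- The `q`-rational `[r/s]_q`, an element of the field `ℤ(q)`, for `r/s = [a₁, …, a_{2m}]`. -/
noncomputable def qRational (a : List ℕ) : RatFunc ℤ :=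
  qContFrac RatFunc.X a

/-- The sum `a₂ + a₄ + ⋯ + a_{2m}` of the entries in even position. -/
def evenSum : List ℕ → ℕ
  | _ :: b :: l => b + evenSum l
  | _ => 0

/-! ### Snake graphs -/

/-- A step from one tile of a snake graph to the next: right or up. -/
inductive Step
  | R
  | U
  deriving DecidableEq

/-- The word `R^a₁ U^a₂ R^a₃ U^a₄ ⋯ R^a_{2m-1} U^a_{2m}`. -/
def fullWord : List ℕ → List Step
  | a :: b :: l => List.replicate a Step.R ++ (List.replicate b Step.U ++ fullWord l)
  | _ => []

/-- The word `R^(a₁ - 1) U^a₂ R^a₃ ⋯ R^a_{2m-1} U^(a_{2m} - 1)` of the snake graph of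
`[a₁, …, a_{2m}]` (all `aᵢ` positive): the first and the last letter of `fullWord` are removed. -/
def snakeWord (a : List ℕ) : List Step :=
  (fullWord a).tail.dropLast

/-- The tiles of the snake graph with word `w`.  A tile is recorded as `(row, column)`, where rows
are counted from the top and columns from the left of the bounding box of the graph, both from `0`
(the convention of `YoungDiagram`).  So the first tile lies in column `0` and in the row whose
index is the number of letters `U` of `w`; the other tiles form the snake graph of the remaining
word, moved one column to the right if the first letter is `R`. -/
def snakeTiles : List Step → Finset (ℕ × ℕ)
  | [] => {(0, 0)}
  | Step.R :: w => insert (w.count Step.U, 0) ((snakeTiles w).image fun c => (c.1, c.2 + 1))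
  | Step.U :: w => insert (w.count Step.U + 1, 0) (snakeTiles w)

/-- The partition `λ(G)` of the snake graph `G` with word `w`: the Young diagram having the same
bottom boundary as `G`, that is, all boxes weakly above and to the left of a tile of `G`. -/
def outerShape (w : List Step) : YoungDiagram where
  cells := (snakeTiles w).biUnion fun c => Finset.Iic c
  isLowerSet := by
    intro c d hdc hc
    simp only [Finset.coe_biUnion, Set.mem_iUnion, Finset.coe_Iic, Set.mem_Iic] at hc ⊢
    obtain ⟨e, he, hce⟩ := hc
    exact ⟨e, he, hdc.trans hce⟩

theorem mem_outerShape {w : List Step} {i j : ℕ} :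
    (i, j) ∈ outerShape w ↔ ∃ e ∈ snakeTiles w, i ≤ e.1 ∧ j ≤ e.2 := by
  rw [← YoungDiagram.mem_cells]
  simp [outerShape, Prod.le_def]

theorem snakeTiles_row_le (w : List Step) : ∀ e ∈ snakeTiles w, e.1 ≤ w.count Step.U := by
  induction w with
  | nil => simp [snakeTiles]
  | cons s w ih =>
    cases s
    · intro e he
      simp only [snakeTiles, Finset.mem_insert, Finset.mem_image] at he
      rcases he with rfl | ⟨c, hc, rfl⟩
      · simp
      · simpa using ih c hc
    · intro e he
      simp only [snakeTiles, Finset.mem_insert] at he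
      rcases he with rfl | he
      · simp
      · have := ih e he
        simp only [List.count_cons_self]
        omega

theorem snakeTiles_first_mem (w : List Step) : (w.count Step.U, 0) ∈ snakeTiles w := by
  rcases w with _ | ⟨_ | _, w⟩ <;> simp [snakeTiles]

/-- `G` is the set of boxes of `λ(G)` adjacent to the bottom boundary of `λ(G)` (at an edge or at
a corner), that is, the boxes whose diagonal successor is not a box of `λ(G)`. -/
theorem mem_snakeTiles_iff (w : List Step) (i j : ℕ) :
    (i, j) ∈ snakeTiles w ↔ (i, j) ∈ outerShape w ∧ (i + 1, j + 1) ∉ outerShape w := by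
  induction w generalizing i j with
  | nil =>
    simp only [mem_outerShape, snakeTiles, Finset.mem_singleton, Prod.mk.injEq]
    constructor
    · rintro ⟨rfl, rfl⟩
      simp
    · rintro ⟨⟨e, rfl, h1, h2⟩, -⟩
      simp only at h1 h2
      omega
  | cons s w ih =>
    have hf := snakeTiles_first_mem w
    have hr := snakeTiles_row_le w
    cases s
    · have key : ∀ i j, (i, j) ∈ outerShape (Step.R :: w) ↔
          (i ≤ w.count Step.U ∧ j = 0) ∨ ∃ j', j = j' + 1 ∧ (i, j') ∈ outerShape w := by
        intro i j
        simp only [mem_outerShape, snakeTiles, Finset.mem_insert, Finset.mem_image]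
        constructor
        · rintro ⟨e, rfl | ⟨c, hc, rfl⟩, h1, h2⟩
          · left; simp only at h1 h2; omega
          · simp only at h1 h2
            rcases j with _ | j
            · left; exact ⟨h1.trans (hr c hc), rfl⟩
            · right; exact ⟨j, rfl, c, hc, h1, by omega⟩
        · rintro (⟨h1, rfl⟩ | ⟨j', rfl, c, hc, h1, h2⟩)
          · exact ⟨_, Or.inl rfl, h1, le_rfl⟩
          · exact ⟨_, Or.inr ⟨c, hc, rfl⟩, h1, by simpa using h2⟩
      rw [key, key]
      simp only [snakeTiles, Finset.mem_insert, Finset.mem_image, Prod.mk.injEq, Prod.exists]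
      rcases j with _ | j
      · have h0 : (i + 1, 0) ∈ outerShape w ↔ i + 1 ≤ w.count Step.U := by
          rw [mem_outerShape]
          exact ⟨fun ⟨e, he, h1, _⟩ => h1.trans (hr e he), fun h => ⟨_, hf, h, le_rfl⟩⟩
        simp [h0]
        omega
      · simp [ih]
    · have key : ∀ i j, (i, j) ∈ outerShape (Step.U :: w) ↔
          (i ≤ w.count Step.U + 1 ∧ j = 0) ∨ (i, j) ∈ outerShape w := by
        intro i j
        simp only [mem_outerShape, snakeTiles, Finset.mem_insert]
        constructor
        · rintro ⟨e, rfl | he, h1, h2⟩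
          · left; simp only at h1 h2; omega
          · right; exact ⟨e, he, h1, h2⟩
        · rintro (⟨h1, rfl⟩ | ⟨c, hc, h1, h2⟩)
          · exact ⟨_, Or.inl rfl, h1, le_rfl⟩
          · exact ⟨c, Or.inr hc, h1, h2⟩
      rw [key, key]
      simp only [snakeTiles, Finset.mem_insert, Prod.mk.injEq, ih]
      have hb : ∀ i j, (i, j) ∈ outerShape w → i ≤ w.count Step.U := fun i j h => by
        obtain ⟨e, he, h1, _⟩ := mem_outerShape.1 h
        exact h1.trans (hr e he)
      have h0 : i ≤ w.count Step.U → (i, 0) ∈ outerShape w := fun h =>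
        mem_outerShape.2 ⟨_, hf, h, le_rfl⟩
      have h1 := hb (i + 1) (j + 1)
      constructor
      · rintro (⟨rfl, rfl⟩ | ⟨h2, h3⟩)
        · refine ⟨Or.inl ⟨le_rfl, rfl⟩, ?_⟩
          rintro (h | h)
          · omega
          · have := h1 h; omega
        · refine ⟨Or.inr h2, ?_⟩
          rintro (h | h)
          · omega
          · exact h3 h
      · rintro ⟨⟨h2, rfl⟩ | h2, h3⟩
        · by_cases hi : i ≤ w.count Step.U
          · exact Or.inr ⟨h0 hi, fun h => h3 (Or.inr h)⟩
          · left; omega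
        · exact Or.inr ⟨h2, fun h => h3 (Or.inr h)⟩

/-- The partition `μ(G)` of the snake graph `G` with word `w`: it consists of the boxes of `λ(G)`
that are not tiles of `G`, so that `G` is the skew Young diagram of shape `λ(G)/μ(G)`. -/
def innerShape (w : List Step) : YoungDiagram where
  cells := (outerShape w).cells \ snakeTiles w
  isLowerSet := by
    rintro ⟨i, j⟩ ⟨i', j'⟩ hdc hc
    simp only [Finset.coe_sdiff, Set.mem_sdiff, Finset.mem_coe, YoungDiagram.mem_cells,
      mem_snakeTiles_iff, not_and, not_not] at hc ⊢
    have h1 : i' ≤ i := hdc.1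
    have h2 : j' ≤ j := hdc.2
    exact ⟨(outerShape w).up_left_mem h1 h2 hc.1, fun _ =>
      (outerShape w).up_left_mem (by omega) (by omega) (hc.2 hc.1)⟩

/-! ### Schubert cells -/

/-- The Grassmannian `Gr_k(n)` of `k`-dimensional subspaces of `K^n`. -/
abbrev Gr (K : Type*) [Field K] (k n : ℕ) : Type _ :=
  {V : Submodule K (Fin n → K) // Module.finrank K V = k}

/-- The elements of the set `I_ν`, listed increasingly, for a partition `ν` inside the
`k × (n - k)` rectangle.  The bottom boundary of `ν` is walked backwards, from the top right to the
bottom left corner of the rectangle, and its steps are labelled `0, …, n - 1`; the vertical step in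
row `i` (rows being counted from `0`) comes after `i` vertical steps and `n - k - νᵢ` horizontal
ones. -/
def pivot (k n : ℕ) (ν : YoungDiagram) (i : Fin k) : ℕ :=
  i + (n - k - ν.rowLen i)

/-- The `k × n` matrix `M` is in reduced row echelon form with the pivot of row `i` in column
`p i`: each row vanishes to the left of its pivot, and the pivot columns form an identity matrix. -/
def IsEchelon {K : Type*} [Field K] {k n : ℕ} (p : Fin k → ℕ) (M : Matrix (Fin k) (Fin n) K) :
    Prop :=
  (∀ (i : Fin k) (j : Fin n), (j : ℕ) < p i → M i j = 0) ∧
    ∀ (i i' : Fin k) (j : Fin n), (j : ℕ) = p i' → M i j = if i = i' then 1 else 0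

/-- The open Schubert cell `Ω°_ν` in `Gr_k(n)`, for a partition `ν` inside the `k × (n - k)`
rectangle: the subspaces which are the row space of a matrix in reduced row echelon form with
pivot columns `I_ν`. -/
def openSchubertCell (K : Type*) [Field K] (k n : ℕ) (ν : YoungDiagram) : Set (Gr K k n) :=
  {V | ∃ M : Matrix (Fin k) (Fin n) K, IsEchelon (pivot k n ν) M ∧
    (V : Submodule K (Fin n → K)) = Submodule.span K (Set.range M.row)}

end QSnake

/-!
Peeling the letters off the snake word one at a time transforms a pair `(N, D)` by the generators of
the `q`-deformed modular group, and `N / D` obeys the recursion of the `q`-continued fraction; as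
the two polynomials are coprime and `D` has positive leading coefficient, `N` is the numerator of
`[r/s]_q`.  The generating functions, by size, of the order ideals of the poset of tiles that
contain, respectively avoid, the first tile satisfy the same recursion: prepending `R` adds a new
minimal tile, covered by the old first one, and prepending `U` adds a new maximal tile, covering it.

The order ideals of the tiles are the `ν \ μ` for `μ ≤ ν ≤ λ`, so `q^|μ| N(q)` is the sum of the
`q^|ν|`.  Row `i` of a reduced row echelon matrix with pivots `I_ν` has `νᵢ` free entries and the
matrix is determined by its row space, so the Schubert cell of `ν` has `q^|ν|` points and distinct
cells are disjoint.
-/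

namespace QSnake

open Finset Polynomial

/-! ### The numerator and denominator attached to a word -/

/-- The pair `(N, D)` attached to a word.  Prepending a letter acts on it by one of the generators
`!![t, 1; 0, 1]` (for `R`) and `!![t, 0; t, 1]` (for `U`) of the `q`-deformed modular group; the
numerator and denominator of a `q`-rational are of this form. -/
def wordPair {A : Type*} [Semiring A] (t : A) : List Step → A × A
  | [] => (1, 1)
  | Step.R :: w => (t * (wordPair t w).1 + (wordPair t w).2, (wordPair t w).2)
  | Step.U :: w => (t * (wordPair t w).1, t * (wordPair t w).1 + (wordPair t w).2)

theorem map_wordPair {A B : Type*} [Semiring A] [Semiring B] (f : A →+* B) (t : A)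
    (w : List Step) : (wordPair t w).map f f = wordPair (f t) w := by
  induction w with
  | nil => simp [wordPair]
  | cons s w ih => cases s <;> simp [wordPair, ← ih]

theorem eval_fst_wordPair (q : ℕ) (w : List Step) :
    (wordPair (X : ℤ[X]) w).1.eval (q : ℤ) = (wordPair q w).1 := by
  have heval := map_wordPair (evalRingHom (q : ℤ)) X w
  have hcast := map_wordPair (Nat.castRingHom ℤ) q w
  rw [coe_evalRingHom, eval_X] at heval
  rw [eq_natCast] at hcast
  exact congrArg Prod.fst (heval.trans hcast.symm)

theorem isCoprime_wordPair {A : Type*} [CommRing A] (t : A) (w : List Step) :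
    IsCoprime (wordPair t w).1 (wordPair t w).2 ∧ IsCoprime t (wordPair t w).2 := by
  induction w with
  | nil => simp [wordPair, isCoprime_one_right]
  | cons s w ih =>
    have hmul : IsCoprime (t * (wordPair t w).1) (wordPair t w).2 := ih.2.mul_left ih.1
    cases s
    · exact ⟨by simpa [wordPair] using hmul.add_mul_right_left 1, ih.2⟩
    · exact ⟨by simpa [wordPair, add_comm] using hmul.add_mul_left_right 1,
        by simpa [wordPair, add_comm] using ih.2.add_mul_left_right (wordPair t w).1⟩

theorem wordPair_pos {A : Type*} [Semiring A] [PartialOrder A] [IsStrictOrderedRing A] {t : A}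
    (ht : 0 < t) (w : List Step) : 0 < (wordPair t w).1 ∧ 0 < (wordPair t w).2 := by
  induction w with
  | nil => simp [wordPair]
  | cons s w ih =>
    have := mul_pos ht ih.1
    cases s
    · exact ⟨add_pos this ih.2, ih.2⟩
    · exact ⟨this, add_pos this ih.2⟩

theorem leadingCoeff_map_natCast_pos {p : ℕ[X]} (hp : p ≠ 0) :
    0 < (p.map (Nat.castRingHom ℤ)).leadingCoeff := by
  rw [leadingCoeff_map_of_injective Nat.cast_injective]
  exact Nat.cast_pos.2 (Nat.pos_of_ne_zero (leadingCoeff_ne_zero.2 hp))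

theorem leadingCoeff_wordPair_pos (w : List Step) :
    0 < (wordPair (X : ℤ[X]) w).1.leadingCoeff ∧ 0 < (wordPair (X : ℤ[X]) w).2.leadingCoeff := by
  have hmap := map_wordPair (mapRingHom (Nat.castRingHom ℤ)) X w
  have heval := map_wordPair (evalRingHom 1) (X : ℕ[X]) w
  rw [coe_mapRingHom, map_X] at hmap
  rw [coe_evalRingHom, eval_X] at heval
  have hpos := wordPair_pos (one_pos : 0 < (1 : ℕ)) w
  rw [← heval] at hpos
  rw [← hmap]
  constructor <;> refine leadingCoeff_map_natCast_pos fun h0 => ?_ <;> simp [h0] at hpos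

theorem wordPair_ratFunc_X (w : List Step) :
    wordPair (RatFunc.X : RatFunc ℤ) w =
      (wordPair X w).map (algebraMap ℤ[X] (RatFunc ℤ)) (algebraMap ℤ[X] (RatFunc ℤ)) := by
  rw [← RatFunc.algebraMap_X, map_wordPair]

theorem wordPair_ratFunc_X_ne_zero (w : List Step) :
    (wordPair (RatFunc.X : RatFunc ℤ) w).1 ≠ 0 ∧ (wordPair (RatFunc.X : RatFunc ℤ) w).2 ≠ 0 := by
  rw [wordPair_ratFunc_X]
  have h := leadingCoeff_wordPair_pos w
  exact ⟨RatFunc.algebraMap_ne_zero (leadingCoeff_ne_zero.1 h.1.ne'),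
    RatFunc.algebraMap_ne_zero (leadingCoeff_ne_zero.1 h.2.ne')⟩

/-! ### The snake word -/

theorem dropLast_fullWord {x y : ℕ} (hx : 0 < x) (hy : 0 < y) (l : List ℕ) :
    (fullWord (x :: y :: l)).dropLast = Step.R :: snakeWord (x :: y :: l) := by
  obtain ⟨x, rfl⟩ := Nat.exists_eq_succ_of_ne_zero hx.ne'
  obtain ⟨y, rfl⟩ := Nat.exists_eq_succ_of_ne_zero hy.ne'
  simp only [snakeWord, fullWord, List.replicate_succ, List.cons_append, List.tail_cons]
  rw [List.dropLast_cons_of_ne_nil (by simp)]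

theorem R_cons_snakeWord_pair {x y : ℕ} (hx : 0 < x) (hy : 0 < y) :
    Step.R :: snakeWord [x, y] = List.replicate x Step.R ++ List.replicate (y - 1) Step.U := by
  obtain ⟨y, rfl⟩ := Nat.exists_eq_succ_of_ne_zero hy.ne'
  rw [← dropLast_fullWord hx hy]
  simp [fullWord, List.replicate_succ', ← List.append_assoc]

theorem R_cons_snakeWord_cons_cons {x y x' y' : ℕ} {l : List ℕ} (hx : 0 < x) (hy : 0 < y)
    (hx' : 0 < x') (hy' : 0 < y') :
    Step.R :: snakeWord (x :: y :: x' :: y' :: l) =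
      List.replicate x Step.R ++
        (List.replicate y Step.U ++ Step.R :: snakeWord (x' :: y' :: l)) := by
  have hne : fullWord (x' :: y' :: l) ≠ [] := by simp [fullWord, hx'.ne']
  rw [← dropLast_fullWord hx hy, ← dropLast_fullWord hx' hy', fullWord,
    List.dropLast_append_of_ne_nil (by simp [hne]), List.dropLast_append_of_ne_nil hne]

@[elab_as_elim]
theorem evenLengthPos_induction {motive : List ℕ → Prop}
    (pair : ∀ x y, 0 < x → 0 < y → motive [x, y])
    (cons_cons : ∀ x y x' y' l, 0 < x → 0 < y → 0 < x' → 0 < y' →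
      motive (x' :: y' :: l) → motive (x :: y :: x' :: y' :: l)) :
    ∀ a : List ℕ, a ≠ [] → Even a.length → (∀ x ∈ a, 0 < x) → motive a
  | [], ha, _, _ => absurd rfl ha
  | [_], _, heven, _ => by simp at heven
  | [x, y], _, _, hpos => pair x y (hpos x (by simp)) (hpos y (by simp))
  | [_, _, _], _, heven, _ => by simp [Nat.even_add_one] at heven
  | x :: y :: x' :: y' :: l, _, heven, hpos =>
    cons_cons x y x' y' l (hpos x (by simp)) (hpos y (by simp)) (hpos x' (by simp))
      (hpos y' (by simp)) (evenLengthPos_induction pair cons_cons (x' :: y' :: l) (by simp)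
        (by simpa [Nat.even_add_one] using heven) fun z hz => hpos z (by simp_all))

theorem evenSum_le_sum (a : List ℕ) : evenSum a ≤ a.sum := by
  fun_induction evenSum a with
  | case1 x y l ih =>
    simp only [List.sum_cons]
    omega
  | case2 => exact Nat.zero_le _

theorem count_snakeWord {a : List ℕ} (ha : a ≠ []) (ha_even : Even a.length)
    (ha_pos : ∀ x ∈ a, 0 < x) :
    (snakeWord a).count Step.U + 1 = evenSum a ∧
      (snakeWord a).count Step.R + 1 + evenSum a = a.sum := by
  suffices h : (Step.R :: snakeWord a).count Step.U + 1 = evenSum a ∧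
      (Step.R :: snakeWord a).count Step.R + evenSum a = a.sum by simpa using h
  refine evenLengthPos_induction (fun x y hx hy => ?_)
    (fun x y x' y' l hx hy hx' hy' ih => ?_) a ha ha_even ha_pos
  · simp only [R_cons_snakeWord_pair hx hy, List.count_append, List.count_replicate, evenSum]
    simp [Nat.sub_add_cancel hy]
  · rw [R_cons_snakeWord_cons_cons hx hy hx' hy', evenSum, List.sum_cons, List.sum_cons (a := y),
      ← ih.1, ← ih.2]
    simp only [List.count_append, List.count_replicate, List.count_cons]
    grind

/-! ### The `q`-continued fraction in lowest terms -/

section ContFrac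

variable {F : Type*} [Field F] {t : F}

theorem qInt_succ (t : F) (a : ℕ) : qInt t (a + 1) = 1 + t * qInt t a := by
  simp [qInt, sum_range_succ', mul_sum, pow_succ', add_comm]

theorem qInt_succ' (t : F) (a : ℕ) : qInt t (a + 1) = qInt t a + t ^ a :=
  sum_range_succ _ _

theorem pow_mul_qInt_inv (ht : t ≠ 0) (b : ℕ) : t ^ b * qInt t⁻¹ b = t * qInt t b := by
  induction b with
  | zero => simp [qInt]
  | succ b ih =>
    calc t ^ (b + 1) * qInt t⁻¹ (b + 1) = t * (t ^ b * qInt t⁻¹ b + t ^ b * t⁻¹ ^ b) := by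
          rw [qInt_succ']; ring
      _ = t * qInt t (b + 1) := by
          rw [ih, ← mul_pow, mul_inv_cancel₀ ht, one_pow, qInt_succ, add_comm]

theorem wordPair_replicate_R_append (t : F) (a : ℕ) (w : List Step) :
    wordPair t (List.replicate a Step.R ++ w) =
      (t ^ a * (wordPair t w).1 + qInt t a * (wordPair t w).2, (wordPair t w).2) := by
  induction a with
  | zero => simp [qInt]
  | succ a ih =>
    rw [List.replicate_succ, List.cons_append, wordPair, ih, qInt_succ]
    ring_nf

theorem wordPair_replicate_U_append (t : F) (b : ℕ) (w : List Step) :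
    wordPair t (List.replicate b Step.U ++ w) =
      (t ^ b * (wordPair t w).1, t * qInt t b * (wordPair t w).1 + (wordPair t w).2) := by
  induction b with
  | zero => simp [qInt]
  | succ b ih =>
    rw [List.replicate_succ, List.cons_append, wordPair, ih, qInt_succ']
    ring_nf

/-- The value `N / D` of the fraction attached to a word. -/
def wordValue (t : F) (w : List Step) : F :=
  (wordPair t w).1 / (wordPair t w).2

theorem wordValue_replicate_R_append {w : List Step} (hw : (wordPair t w).2 ≠ 0) (a : ℕ) :
    wordValue t (List.replicate a Step.R ++ w) = qInt t a + t ^ a * wordValue t w := by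
  rw [wordValue, wordValue, wordPair_replicate_R_append]
  field_simp
  ring

theorem inv_wordValue_replicate_U_append (ht : t ≠ 0) {w : List Step} (hw : (wordPair t w).1 ≠ 0)
    (b : ℕ) : (wordValue t (List.replicate b Step.U ++ w))⁻¹ =
      qInt t⁻¹ b + t⁻¹ ^ b * (wordValue t w)⁻¹ := by
  rw [wordValue, wordValue, wordPair_replicate_U_append, inv_div, inv_div, ← pow_mul_qInt_inv ht,
    inv_pow]
  field_simp

theorem qContFrac_eq_wordValue (ht : t ≠ 0)
    (hne : ∀ w, (wordPair t w).1 ≠ 0 ∧ (wordPair t w).2 ≠ 0) {a : List ℕ} (ha : a ≠ [])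
    (ha_even : Even a.length) (ha_pos : ∀ x ∈ a, 0 < x) :
    qContFrac t a = wordValue t (Step.R :: snakeWord a) := by
  refine evenLengthPos_induction (fun x y hx hy => ?_)
    (fun x y x' y' l hx hy hx' hy' ih => ?_) a ha ha_even ha_pos
  · have hU := inv_wordValue_replicate_U_append ht (hne []).1 (y - 1)
    have hlast : (wordValue t [])⁻¹ = 1 := by simp [wordValue, wordPair]
    rw [hlast, mul_one, ← qInt_succ', Nat.sub_add_cancel hy, List.append_nil] at hU
    rw [R_cons_snakeWord_pair hx hy, wordValue_replicate_R_append (hne _).2, qContFrac, qContFrac,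
      ← hU, div_inv_eq_mul]
  · rw [R_cons_snakeWord_cons_cons hx hy hx' hy', wordValue_replicate_R_append (hne _).2,
      qContFrac, qContFrac, inv_inv, ih, div_eq_mul_inv (t⁻¹ ^ y),
      ← inv_wordValue_replicate_U_append ht (hne _).1, div_inv_eq_mul]

end ContFrac

theorem qRational_eq_div {a : List ℕ} (ha : a ≠ []) (ha_even : Even a.length)
    (ha_pos : ∀ x ∈ a, 0 < x) :
    qRational a =
      algebraMap ℤ[X] (RatFunc ℤ) (wordPair X (Step.R :: snakeWord a)).1 /
        algebraMap ℤ[X] (RatFunc ℤ) (wordPair X (Step.R :: snakeWord a)).2 := by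
  have hX : (RatFunc.X : RatFunc ℤ) ≠ 0 := by
    rw [← RatFunc.algebraMap_X]
    exact RatFunc.algebraMap_ne_zero X_ne_zero
  rw [qRational, qContFrac_eq_wordValue hX wordPair_ratFunc_X_ne_zero ha ha_even ha_pos,
    wordValue, wordPair_ratFunc_X, Prod.map_fst, Prod.map_snd]

theorem associated_of_isRelPrime_of_mul_eq_mul {A : Type*} [CommMonoidWithZero A]
    [IsCancelMulZero A] [DecompositionMonoid A] {r s r' s' : A} (h : IsRelPrime r s)
    (h' : IsRelPrime r' s') (heq : r * s' = r' * s) : Associated s s' :=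
  associated_of_dvd_dvd (h.symm.dvd_of_dvd_mul_left ⟨r', heq.trans (mul_comm _ _)⟩)
    (h'.symm.dvd_of_dvd_mul_left ⟨r, heq.symm.trans (mul_comm _ _)⟩)

theorem eq_of_associated_of_leadingCoeff_pos {p p' : ℤ[X]} (h : Associated p p')
    (hp : 0 < p.leadingCoeff) (hp' : 0 < p'.leadingCoeff) : p = p' := by
  obtain ⟨u, rfl⟩ := h
  obtain ⟨c, hc, hcu⟩ := Polynomial.isUnit_iff.1 u.isUnit
  rw [leadingCoeff_mul, ← hcu, leadingCoeff_C] at hp'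
  obtain rfl : c = 1 :=
    (Int.isUnit_iff.1 hc).resolve_right fun h => by linarith [pos_of_mul_pos_right hp' hp.le]
  rw [← hcu, C_1, mul_one]

theorem numerator_eq_of_div_eq_div {R S R' S' : ℤ[X]} (h : IsRelPrime R S)
    (h' : IsRelPrime R' S') (hS : 0 < S.leadingCoeff) (hS' : 0 < S'.leadingCoeff)
    (heq : algebraMap ℤ[X] (RatFunc ℤ) R / algebraMap ℤ[X] (RatFunc ℤ) S =
      algebraMap ℤ[X] (RatFunc ℤ) R' / algebraMap ℤ[X] (RatFunc ℤ) S') : R = R' := by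
  have hS0 : S ≠ 0 := leadingCoeff_ne_zero.1 hS.ne'
  have hS0' : S' ≠ 0 := leadingCoeff_ne_zero.1 hS'.ne'
  rw [div_eq_div_iff (RatFunc.algebraMap_ne_zero hS0) (RatFunc.algebraMap_ne_zero hS0'),
    ← map_mul, ← map_mul] at heq
  have hmul : R * S' = R' * S := RatFunc.algebraMap_injective ℤ heq
  obtain rfl : S = S' := eq_of_associated_of_leadingCoeff_pos
    (associated_of_isRelPrime_of_mul_eq_mul h h' hmul) hS hS'
  exact mul_right_cancel₀ hS0 hmul

theorem numerator_qRational_eq {a : List ℕ} (ha : a ≠ []) (ha_even : Even a.length)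
    (ha_pos : ∀ x ∈ a, 0 < x) {R S : ℤ[X]} (hcop : IsRelPrime R S) (hS : 0 < S.leadingCoeff)
    (hRS : qRational a = algebraMap ℤ[X] (RatFunc ℤ) R / algebraMap ℤ[X] (RatFunc ℤ) S) :
    R = (wordPair X (Step.R :: snakeWord a)).1 :=
  numerator_eq_of_div_eq_div hcop (isCoprime_wordPair X (Step.R :: snakeWord a)).1.isRelPrime hS
    (leadingCoeff_wordPair_pos (Step.R :: snakeWord a)).2
    (hRS.symm.trans (qRational_eq_div ha ha_even ha_pos))

/-! ### Order ideals -/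

section OrderIdeals

variable {α β : Type*}

open Classical in
/-- The order ideals (lower sets) of the finite poset `T`, as a finite set; used to count them by
size. -/
noncomputable def orderIdeals [LE α] (T : Finset α) : Finset (Finset α) :=
  {S ∈ T.powerset | ∀ c ∈ S, ∀ d ∈ T, d ≤ c → d ∈ S}

theorem mem_orderIdeals [LE α] {S T : Finset α} :
    S ∈ orderIdeals T ↔ S ⊆ T ∧ ∀ c ∈ S, ∀ d ∈ T, d ≤ c → d ∈ S := by
  simp [orderIdeals]

theorem orderIdeals_singleton [DecidableEq α] [Preorder α] (x : α) :
    orderIdeals {x} = {∅, {x}} := by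
  ext S
  rw [mem_orderIdeals, subset_singleton_iff, mem_insert, mem_singleton, and_iff_left_iff_imp]
  rintro (rfl | rfl) <;> simp

theorem orderIdeals_map [LE α] [LE β] (e : α ↪o β) (T : Finset α) :
    orderIdeals (T.map e.toEmbedding) =
      (orderIdeals T).map (mapEmbedding e.toEmbedding).toEmbedding := by
  ext S
  rw [mem_map]
  constructor
  · intro hS
    obtain ⟨hST, hlow⟩ := mem_orderIdeals.1 hS
    obtain ⟨S, hS', rfl⟩ := subset_map_iff.1 hST
    refine ⟨S, mem_orderIdeals.2 ⟨hS', ?_⟩, rfl⟩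
    simpa [e.map_rel_iff] using hlow
  · rintro ⟨S, hS, rfl⟩
    obtain ⟨hST, hlow⟩ := mem_orderIdeals.1 hS
    refine mem_orderIdeals.2 ⟨map_subset_map.2 hST, ?_⟩
    simpa [e.map_rel_iff] using hlow

variable [DecidableEq α]

section Insert

variable [Preorder α] {x y : α} {T : Finset α}

theorem filter_mem_orderIdeals_insert_of_forall_not_le (hx : ∀ c ∈ T, ¬c ≤ x) :
    {S ∈ orderIdeals (insert x T) | x ∈ S} = (orderIdeals T).image (insert x) := by
  have : x ∉ T := fun h => hx x h le_rfl
  ext S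
  simp only [mem_filter, mem_image, mem_orderIdeals]
  constructor
  · rintro ⟨⟨hST, hlow⟩, hxS⟩
    exact ⟨S.erase x, ⟨subset_insert_iff.1 hST, by grind⟩, insert_erase hxS⟩
  · rintro ⟨S, ⟨hST, hlow⟩, rfl⟩
    exact ⟨⟨insert_subset_insert x hST, by grind⟩, mem_insert_self x S⟩

theorem filter_notMem_orderIdeals_insert_of_forall_le_iff (hy : y ∈ T)
    (hxy : ∀ c ∈ T, x ≤ c ↔ y ≤ c) :
    {S ∈ orderIdeals (insert x T) | x ∉ S} = {S ∈ orderIdeals T | y ∉ S} := by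
  have hle : x ≤ y := (hxy y hy).2 le_rfl
  ext S
  simp only [mem_filter, mem_orderIdeals]
  grind

theorem filter_mem_orderIdeals_insert_of_forall_ge_iff (hxT : x ∉ T) (hy : y ∈ T)
    (hxy : ∀ c ∈ T, c ≤ x ↔ c ≤ y) :
    {S ∈ orderIdeals (insert x T) | x ∈ S} =
      {S ∈ orderIdeals T | y ∈ S}.image (insert x) := by
  have hle : y ≤ x := (hxy y hy).2 le_rfl
  ext S
  simp only [mem_filter, mem_image, mem_orderIdeals]
  constructor
  · rintro ⟨⟨hST, hlow⟩, hxS⟩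
    exact ⟨S.erase x, ⟨⟨subset_insert_iff.1 hST, by grind⟩, by grind⟩, insert_erase hxS⟩
  · rintro ⟨S, ⟨⟨hST, hlow⟩, hyS⟩, rfl⟩
    exact ⟨⟨insert_subset_insert x hST, by grind⟩, mem_insert_self x S⟩

theorem filter_notMem_orderIdeals_insert_of_forall_not_ge (hx : ∀ c ∈ T, ¬x ≤ c) :
    {S ∈ orderIdeals (insert x T) | x ∉ S} = orderIdeals T := by
  have hxT : x ∉ T := fun h => hx x h le_rfl
  ext S
  simp only [mem_filter, mem_orderIdeals]
  grind

end Insert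

theorem sum_pow_card_image_insert {A : Type*} [CommSemiring A] (t : A) {x : α}
    {𝒜 : Finset (Finset α)} (h : ∀ S ∈ 𝒜, x ∉ S) :
    ∑ S ∈ 𝒜.image (insert x), t ^ #S = t * ∑ S ∈ 𝒜, t ^ #S := by
  rw [sum_image (insert_erase_invOn.2.injOn.mono h), mul_sum]
  exact sum_congr rfl fun S hS => by rw [card_insert_of_notMem (h S hS), pow_succ']

end OrderIdeals

/-! ### Order ideals of the poset of tiles -/

/-- Moving a box one column to the right, the operation on tiles in the recursion for
`snakeTiles`. -/
def shiftRight : ℕ × ℕ ↪o ℕ × ℕ where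
  toFun c := (c.1, c.2 + 1)
  inj' _ _ h := by simpa [Prod.ext_iff] using h
  map_rel_iff' {c d} := by
    change (c.1, c.2 + 1) ≤ (d.1, d.2 + 1) ↔ c ≤ d
    simp [Prod.le_def]

@[simp]
theorem shiftRight_apply (c : ℕ × ℕ) : shiftRight c = (c.1, c.2 + 1) := rfl

theorem snakeTiles_R_cons (w : List Step) :
    snakeTiles (Step.R :: w) =
      insert (w.count Step.U, 0) ((snakeTiles w).map shiftRight.toEmbedding) := by
  rw [snakeTiles, map_eq_image]
  rfl

theorem filter_mem_orderIdeals_snakeTiles_R_cons (w : List Step) :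
    {S ∈ orderIdeals (snakeTiles (Step.R :: w)) | (w.count Step.U, 0) ∈ S} =
      ((orderIdeals (snakeTiles w)).map (mapEmbedding shiftRight.toEmbedding).toEmbedding).image
        (insert (w.count Step.U, 0)) := by
  rw [snakeTiles_R_cons, filter_mem_orderIdeals_insert_of_forall_not_le, orderIdeals_map]
  rintro _ hc
  obtain ⟨c, -, rfl⟩ := mem_map.1 hc
  simp [Prod.le_def]

theorem filter_notMem_orderIdeals_snakeTiles_R_cons (w : List Step) :
    {S ∈ orderIdeals (snakeTiles (Step.R :: w)) | (w.count Step.U, 0) ∉ S} =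
      {S ∈ orderIdeals (snakeTiles w) | (w.count Step.U, 0) ∉ S}.map
        (mapEmbedding shiftRight.toEmbedding).toEmbedding := by
  rw [snakeTiles_R_cons, filter_notMem_orderIdeals_insert_of_forall_le_iff
    (mem_map_of_mem shiftRight.toEmbedding (snakeTiles_first_mem w)), orderIdeals_map, filter_map]
  · simp
  · rintro _ hc
    obtain ⟨c, -, rfl⟩ := mem_map.1 hc
    simp [Prod.le_def]

theorem filter_mem_orderIdeals_snakeTiles_U_cons (w : List Step) :
    {S ∈ orderIdeals (snakeTiles (Step.U :: w)) | (w.count Step.U + 1, 0) ∈ S} =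
      {S ∈ orderIdeals (snakeTiles w) | (w.count Step.U, 0) ∈ S}.image
        (insert (w.count Step.U + 1, 0)) := by
  refine filter_mem_orderIdeals_insert_of_forall_ge_iff (fun h => ?_) (snakeTiles_first_mem w)
    fun c hc => ?_
  · exact absurd (snakeTiles_row_le w _ h) (by simp)
  · have := snakeTiles_row_le w c hc
    simp only [Prod.le_def]
    omega

theorem filter_notMem_orderIdeals_snakeTiles_U_cons (w : List Step) :
    {S ∈ orderIdeals (snakeTiles (Step.U :: w)) | (w.count Step.U + 1, 0) ∉ S} =
      orderIdeals (snakeTiles w) :=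
  filter_notMem_orderIdeals_insert_of_forall_not_ge fun c hc h =>
    absurd (h.1.trans (snakeTiles_row_le w c hc)) (by simp)

theorem sum_orderIdeals_snakeTiles_filter {A : Type*} [CommSemiring A] (t : A) (w : List Step) :
    ∑ S ∈ orderIdeals (snakeTiles w) with (w.count Step.U, 0) ∈ S, t ^ #S =
        t * (wordPair t w).1 ∧
      ∑ S ∈ orderIdeals (snakeTiles w) with (w.count Step.U, 0) ∉ S, t ^ #S =
        (wordPair t w).2 := by
  induction w with
  | nil => simp [snakeTiles, orderIdeals_singleton, wordPair, filter_insert, filter_singleton]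
  | cons s w ih =>
    have hsum : ∑ S ∈ orderIdeals (snakeTiles w), t ^ #S =
        t * (wordPair t w).1 + (wordPair t w).2 := by
      rw [← ih.1, ← ih.2, sum_filter_add_sum_filter_not]
    cases s
    · simp only [List.count_cons_of_ne (by simp : Step.R ≠ Step.U)]
      rw [filter_mem_orderIdeals_snakeTiles_R_cons, filter_notMem_orderIdeals_snakeTiles_R_cons,
        sum_pow_card_image_insert]
      · simp [hsum, ih.2, wordPair]
      · simp
    · simp only [List.count_cons_self]
      rw [filter_mem_orderIdeals_snakeTiles_U_cons, filter_notMem_orderIdeals_snakeTiles_U_cons,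
        hsum, sum_pow_card_image_insert, ih.1]
      · simp [wordPair]
      · intro S hS h
        have hST := (mem_orderIdeals.1 (mem_of_mem_filter S hS)).1
        exact absurd (snakeTiles_row_le w _ (hST h)) (by simp)

theorem sum_orderIdeals_snakeTiles {A : Type*} [CommSemiring A] (t : A) (w : List Step) :
    ∑ S ∈ orderIdeals (snakeTiles w), t ^ #S = (wordPair t (Step.R :: w)).1 := by
  rw [wordPair, ← (sum_orderIdeals_snakeTiles_filter t w).1,
    ← (sum_orderIdeals_snakeTiles_filter t w).2, sum_filter_add_sum_filter_not]

/-! ### Partitions between `μ` and `λ` -/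

theorem bijOn_cells_sdiff_Icc {μ Λ : YoungDiagram} (h : μ ≤ Λ) :
    Set.BijOn (fun ν : YoungDiagram => ν.cells \ μ.cells) (Set.Icc μ Λ)
      (orderIdeals (Λ.cells \ μ.cells)) := by
  refine ⟨fun ν hν => ?_, fun ν hν ν' hν' heq => ?_, fun S hS => ?_⟩
  · refine mem_orderIdeals.2 ⟨sdiff_subset_sdiff hν.2 subset_rfl, fun c hc d hd hdc => ?_⟩
    rw [mem_sdiff] at hc hd ⊢
    exact ⟨ν.isLowerSet hdc hc.1, hd.2⟩
  · ext1
    rw [← sdiff_union_of_subset hν.1, ← sdiff_union_of_subset hν'.1]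
    exact congrArg (· ∪ μ.cells) heq
  · obtain ⟨hSΛ, hlow⟩ := mem_orderIdeals.1 hS
    rw [subset_sdiff] at hSΛ
    have hlower : IsLowerSet ((μ.cells ∪ S : Finset (ℕ × ℕ)) : Set (ℕ × ℕ)) := by
      intro c d hdc hc
      have hμ : c ∈ μ.cells → d ∈ μ.cells := fun h => μ.isLowerSet hdc h
      have hΛ : c ∈ Λ.cells → d ∈ Λ.cells := fun h => Λ.isLowerSet hdc h
      simp only [coe_union, Set.mem_union, mem_coe] at hc ⊢
      grind
    exact ⟨⟨μ.cells ∪ S, hlower⟩, ⟨subset_union_left, union_subset h hSΛ.1⟩,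
      union_sdiff_cancel_left hSΛ.2.symm⟩

theorem finsum_mem_Icc_pow_card {A : Type*} [CommSemiring A] (t : A) {μ Λ : YoungDiagram}
    (h : μ ≤ Λ) :
    ∑ᶠ ν ∈ Set.Icc μ Λ, t ^ ν.card =
      t ^ μ.card * ∑ S ∈ orderIdeals (Λ.cells \ μ.cells), t ^ #S := by
  rw [mul_sum, ← finsum_mem_coe_finset]
  refine finsum_mem_eq_of_bijOn _ (bijOn_cells_sdiff_Icc h) fun ν hν => ?_
  rw [← pow_add, YoungDiagram.card, YoungDiagram.card, add_comm,
    card_sdiff_add_card_eq_card (YoungDiagram.cells_subset_iff.2 hν.1)]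

theorem snakeTiles_subset_cells_outerShape (w : List Step) :
    snakeTiles w ⊆ (outerShape w).cells :=
  fun c hc => ((mem_snakeTiles_iff w c.1 c.2).1 hc).1

theorem innerShape_le_outerShape (w : List Step) : innerShape w ≤ outerShape w :=
  YoungDiagram.cells_subset_iff.1 sdiff_subset

theorem cells_outerShape_sdiff_cells_innerShape (w : List Step) :
    (outerShape w).cells \ (innerShape w).cells = snakeTiles w :=
  Finset.sdiff_sdiff_eq_self (snakeTiles_subset_cells_outerShape w)

theorem finsum_mem_Icc_innerShape_outerShape {A : Type*} [CommSemiring A] (t : A)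
    (w : List Step) :
    ∑ᶠ ν ∈ Set.Icc (innerShape w) (outerShape w), t ^ ν.card =
      t ^ (innerShape w).card * (wordPair t (Step.R :: w)).1 := by
  rw [finsum_mem_Icc_pow_card t (innerShape_le_outerShape w),
    cells_outerShape_sdiff_cells_innerShape, sum_orderIdeals_snakeTiles]

theorem finite_Icc_youngDiagram (μ Λ : YoungDiagram) : (Set.Icc μ Λ).Finite :=
  .of_finite_image ((Λ.cells.powerset.finite_toSet).subset (by
    rintro _ ⟨ν, hν, rfl⟩
    simpa using YoungDiagram.cells_subset_iff.2 hν.2))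
    (fun _ _ _ _ h => YoungDiagram.ext h : Set.InjOn YoungDiagram.cells _)

/-! ### Matrices in reduced row echelon form -/

section Echelon

variable {K : Type*} [Field K] {k n : ℕ} {p p' : Fin k → ℕ} {M M' : Matrix (Fin k) (Fin n) K}

theorem IsEchelon.apply_pivot (h : IsEchelon p M) (hp : ∀ i, p i < n) (i i' : Fin k) :
    M i ⟨p i', hp i'⟩ = if i = i' then 1 else 0 :=
  h.2 i i' _ rfl

theorem IsEchelon.sum_smul_row_apply_pivot (h : IsEchelon p M) (hp : ∀ i, p i < n) (c : Fin k → K)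
    (i : Fin k) : (∑ i', c i' • M.row i') ⟨p i, hp i⟩ = c i := by
  simp [Finset.sum_apply, h.apply_pivot hp]

theorem IsEchelon.eq_sum_of_mem_span (h : IsEchelon p M) (hp : ∀ i, p i < n) {v : Fin n → K}
    (hv : v ∈ Submodule.span K (Set.range M.row)) : v = ∑ i, v ⟨p i, hp i⟩ • M.row i := by
  obtain ⟨c, rfl⟩ := (Submodule.mem_span_range_iff_exists_fun K).1 hv
  simp_rw [h.sum_smul_row_apply_pivot hp]

theorem IsEchelon.linearIndependent (h : IsEchelon p M) (hp : ∀ i, p i < n) :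
    LinearIndependent K M.row :=
  Fintype.linearIndependent_iff.2 fun c hc i => by
    rw [← h.sum_smul_row_apply_pivot hp c i, hc, Pi.zero_apply]

theorem IsEchelon.finrank_span (h : IsEchelon p M) (hp : ∀ i, p i < n) :
    Module.finrank K (Submodule.span K (Set.range M.row)) = k := by
  rw [finrank_span_eq_card (h.linearIndependent hp), Fintype.card_fin]

theorem IsEchelon.range_pivots_subset (h : IsEchelon p M) (h' : IsEchelon p' M')
    (hp : ∀ i, p i < n) (hp' : ∀ i, p' i < n)
    (hspan : Submodule.span K (Set.range M.row) ≤ Submodule.span K (Set.range M'.row)) :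
    Set.range p ⊆ Set.range p' := by
  rintro _ ⟨i, rfl⟩
  have hrow : M.row i ∈ Submodule.span K (Set.range M'.row) :=
    hspan (Submodule.subset_span (Set.mem_range_self i))
  have hne : M.row i ⟨p i, hp i⟩ ≠ 0 := by simp [h.apply_pivot hp]
  rw [h'.eq_sum_of_mem_span hp' hrow, Finset.sum_apply] at hne
  -- Row `i` of `M` is nonzero in column `p' i'` and row `i'` of `M'` in column `p i`.
  obtain ⟨i', -, hi'⟩ := exists_ne_zero_of_sum_ne_zero hne
  rw [Pi.smul_apply, smul_eq_mul] at hi'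
  exact ⟨i', le_antisymm (not_lt.1 fun hlt => right_ne_zero_of_mul hi' (h'.1 i' _ hlt))
    (not_lt.1 fun hlt => left_ne_zero_of_mul hi' (h.1 i _ hlt))⟩

theorem IsEchelon.pivots_eq (h : IsEchelon p M) (h' : IsEchelon p' M') (hp : ∀ i, p i < n)
    (hp' : ∀ i, p' i < n) (hm : StrictMono p) (hm' : StrictMono p')
    (hspan : Submodule.span K (Set.range M.row) = Submodule.span K (Set.range M'.row)) :
    p = p' :=
  (hm.range_inj hm').1 ((h.range_pivots_subset h' hp hp' hspan.le).antisymm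
    (h'.range_pivots_subset h hp' hp hspan.ge))

theorem IsEchelon.eq_of_span_le (h : IsEchelon p M) (h' : IsEchelon p M') (hp : ∀ i, p i < n)
    (hspan : Submodule.span K (Set.range M.row) ≤ Submodule.span K (Set.range M'.row)) :
    M = M' := by
  ext i j
  have hrow : M.row i = M'.row i := by
    rw [h'.eq_sum_of_mem_span hp (hspan (Submodule.subset_span (Set.mem_range_self i)))]
    simp only [Matrix.row_apply, h.apply_pivot hp, ite_smul, one_smul, zero_smul, sum_ite_eq,
      mem_univ, if_true]
  exact congrFun hrow j

/-- The columns in which row `i` of a matrix in reduced row echelon form with pivots `p` is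
unconstrained: those to the right of `p i` that are not pivot columns. -/
def freeColumns (n : ℕ) (p : Fin k → ℕ) (i : Fin k) : Finset (Fin n) :=
  {j | p i < j ∧ ∀ i', p i' ≠ j}

theorem mem_freeColumns {i : Fin k} {j : Fin n} :
    j ∈ freeColumns n p i ↔ p i < j ∧ ∀ i', p i' ≠ j := by
  simp [freeColumns]

theorem isEchelon_iff_forall_notMem_freeColumns (hinj : Function.Injective p) :
    IsEchelon p M ↔
      ∀ i, ∀ j ∉ freeColumns n p i, M i j = if (j : ℕ) = p i then 1 else 0 := by
  simp only [mem_freeColumns, not_and_or, not_lt, not_forall, not_not]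
  constructor
  · rintro ⟨hleft, hpivot⟩ i j (hj | ⟨i', hi'⟩)
    · rcases hj.lt_or_eq with hlt | heq
      · rw [hleft i j hlt, if_neg hlt.ne]
      · rw [hpivot i i j heq, if_pos rfl, if_pos heq]
    · simp [hpivot i i' j hi'.symm, ← hi', hinj.eq_iff, eq_comm]
  · intro h
    refine ⟨fun i j hj => ?_, fun i i' j hj => ?_⟩
    · rw [h i j (.inl hj.le), if_neg hj.ne]
    · simp [h i j (.inr ⟨i', hj.symm⟩), hj, hinj.eq_iff, eq_comm]

theorem card_freeColumns_add (hp : ∀ i, p i < n) (hm : StrictMono p) (i : Fin k) :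
    #(freeColumns n p i) + (k - 1 - i) = n - 1 - p i := by
  let f : Fin k ↪ Fin n := ⟨fun i => ⟨p i, hp i⟩, fun _ _ h => hm.injective (congrArg Fin.val h)⟩
  have hf : ∀ i, (f i : ℕ) = p i := fun _ => rfl
  have hfree : freeColumns n p i = {j ∈ Ioi (f i) | j ∉ Set.range f} := by
    ext j
    simp [mem_freeColumns, Fin.lt_def, Fin.ext_iff, hf]
  have hpivots : (Ioi i).map f = {j ∈ Ioi (f i) | ¬j ∉ Set.range f} := by
    ext j
    simp only [mem_map, mem_filter, mem_Ioi, not_not, Set.mem_range]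
    constructor
    · rintro ⟨i', hi', rfl⟩
      exact ⟨hm hi', i', rfl⟩
    · rintro ⟨hlt, i', rfl⟩
      exact ⟨i', hm.lt_iff_lt.1 hlt, rfl⟩
  rw [← Fin.card_Ioi i, ← card_map f, hpivots, hfree, card_filter_add_card_filter_not,
    Fin.card_Ioi, hf]

theorem ncard_forall_notMem_eq {l m R : Type*} [Fintype l] [Finite m] [Fintype R]
    (F : l → Finset m) (M₀ : l → m → R) :
    {M : l → m → R | ∀ i, ∀ j ∉ F i, M i j = M₀ i j}.ncard =
      Fintype.card R ^ ∑ i, #(F i) := by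
  classical
  have := Fintype.ofFinite m
  let T (i : l) (j : m) : Finset R := if j ∈ F i then univ else {M₀ i j}
  have hT : {M : l → m → R | ∀ i, ∀ j ∉ F i, M i j = M₀ i j} =
      (Fintype.piFinset fun i => Fintype.piFinset (T i) :
        Finset (l → m → R)) := by
    ext M
    simp only [Set.mem_ofPred_eq, mem_coe, Fintype.mem_piFinset, T]
    grind
  have hcard (i : l) (j : m) : #(T i j) = if j ∈ F i then Fintype.card R else 1 := by
    simp only [T, apply_ite card, card_univ, card_singleton]
  rw [hT, Set.ncard_coe_finset]
  simp [hcard, prod_ite_mem, prod_pow_eq_pow_sum]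

theorem ncard_isEchelon [Fintype K] (hinj : Function.Injective p) :
    {M : Matrix (Fin k) (Fin n) K | IsEchelon p M}.ncard =
      Fintype.card K ^ ∑ i, #(freeColumns n p i) := by
  simp_rw [isEchelon_iff_forall_notMem_freeColumns hinj]
  exact ncard_forall_notMem_eq (freeColumns n p) fun i j => if (j : ℕ) = p i then 1 else 0

end Echelon

/-! ### Schubert cells -/

section Schubert

variable {k n : ℕ} {Λ ν ν' : YoungDiagram}

/-- The Young diagram `ν` fits inside the `k × m` rectangle. -/
def InRectangle (k m : ℕ) (ν : YoungDiagram) : Prop :=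
  ∀ c ∈ ν, c.1 < k ∧ c.2 < m

theorem InRectangle.mono {m : ℕ} (h : InRectangle k m Λ) (hle : ν ≤ Λ) : InRectangle k m ν :=
  fun c hc => h c (hle hc)

theorem InRectangle.rowLen_le {m : ℕ} (h : InRectangle k m ν) (i : ℕ) : ν.rowLen i ≤ m :=
  not_lt.1 fun hlt => lt_irrefl m (h (i, m) (YoungDiagram.mem_iff_lt_rowLen.2 hlt)).2

theorem InRectangle.sum_rowLen {m : ℕ} (h : InRectangle k m ν) :
    ∑ i : Fin k, ν.rowLen i = ν.card := by
  rw [Fin.sum_univ_eq_sum_range (fun i => ν.rowLen i) k, YoungDiagram.card,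
    card_eq_sum_card_fiberwise (f := Prod.fst) (t := range k)
      fun c hc => mem_coe.2 (mem_range.2 (h c hc).1)]
  exact sum_congr rfl fun i _ => ν.rowLen_eq_card

theorem eq_of_rowLen_eq (h : ν.rowLen = ν'.rowLen) : ν = ν' := by
  ext ⟨i, j⟩
  simp only [YoungDiagram.mem_cells, YoungDiagram.mem_iff_lt_rowLen, h]

theorem InRectangle.rowLen_eq_zero {m : ℕ} (h : InRectangle k m ν) {i : ℕ} (hi : k ≤ i) :
    ν.rowLen i = 0 :=
  Nat.eq_zero_of_not_pos fun hpos => hi.not_gt (h (i, 0) (YoungDiagram.mem_iff_lt_rowLen.2 hpos)).1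

theorem pivot_strictMono (k n : ℕ) (ν : YoungDiagram) : StrictMono (pivot k n ν) := by
  intro i j hij
  have hrow := ν.rowLen_anti i j hij.le
  have : (i : ℕ) < j := hij
  simp only [pivot]
  omega

theorem pivot_lt (hkn : k ≤ n) (ν : YoungDiagram) (i : Fin k) : pivot k n ν i < n := by
  simp only [pivot]
  omega

theorem InRectangle.eq_of_pivot_eq (h : InRectangle k (n - k) ν) (h' : InRectangle k (n - k) ν')
    (heq : pivot k n ν = pivot k n ν') : ν = ν' := by
  refine eq_of_rowLen_eq (funext fun i => ?_)
  rcases lt_or_ge i k with hi | hi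
  · have hpivot := congrFun heq ⟨i, hi⟩
    have hle := h.rowLen_le i
    have hle' := h'.rowLen_le i
    simp only [pivot] at hpivot
    omega
  · rw [h.rowLen_eq_zero hi, h'.rowLen_eq_zero hi]

theorem InRectangle.card_freeColumns_pivot (h : InRectangle k (n - k) ν) (hkn : k ≤ n)
    (i : Fin k) : #(freeColumns n (pivot k n ν) i) = ν.rowLen i := by
  have hcard := card_freeColumns_add (pivot_lt hkn ν) (pivot_strictMono k n ν) i
  have hle := h.rowLen_le i
  simp only [pivot] at hcard
  omega

variable (K : Type*) [Field K]

theorem InRectangle.ncard_openSchubertCell [Fintype K] (h : InRectangle k (n - k) ν)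
    (hkn : k ≤ n) : (openSchubertCell K k n ν).ncard = Fintype.card K ^ ν.card := by
  have hp := pivot_lt hkn ν
  rw [← h.sum_rowLen, ← sum_congr rfl fun i _ => h.card_freeColumns_pivot hkn i,
    ← ncard_isEchelon (pivot_strictMono k n ν).injective]
  symm
  refine Set.ncard_congr
    (fun M (hM : IsEchelon _ M) => ⟨Submodule.span K (Set.range M.row), hM.finrank_span hp⟩)
    (fun M hM => ⟨M, hM, rfl⟩) (fun M M' hM hM' heq => ?_) ?_
  · exact IsEchelon.eq_of_span_le hM hM' hp (Subtype.ext_iff.1 heq).le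
  · rintro V ⟨M, hM, hV⟩
    exact ⟨M, hM, Subtype.ext hV.symm⟩

theorem InRectangle.disjoint_openSchubertCell (h : InRectangle k (n - k) ν)
    (h' : InRectangle k (n - k) ν') (hkn : k ≤ n) (hne : ν ≠ ν') :
    Disjoint (openSchubertCell K k n ν) (openSchubertCell K k n ν') := by
  rw [Set.disjoint_left]
  rintro V ⟨M, hM, hV⟩ ⟨M', hM', hV'⟩
  exact hne (h.eq_of_pivot_eq h' (hM.pivots_eq hM' (pivot_lt hkn ν) (pivot_lt hkn ν')
    (pivot_strictMono k n ν) (pivot_strictMono k n ν') (hV.symm.trans hV')))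

theorem InRectangle.ncard_biUnion_openSchubertCell [Fintype K] (h : InRectangle k (n - k) Λ)
    (hkn : k ≤ n) (μ : YoungDiagram) :
    (⋃ ν ∈ Set.Icc μ Λ, openSchubertCell K k n ν).ncard =
      ∑ᶠ ν ∈ Set.Icc μ Λ, Fintype.card K ^ ν.card := by
  have hν {ν} (hν : ν ∈ Set.Icc μ Λ) : InRectangle k (n - k) ν := h.mono hν.2
  rw [(finite_Icc_youngDiagram μ Λ).ncard_biUnion (fun _ _ => Set.toFinite _)
    fun ν h₁ ν' h₂ => (hν h₁).disjoint_openSchubertCell K (hν h₂) hkn]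
  exact finsum_mem_congr rfl fun ν h₁ => (hν h₁).ncard_openSchubertCell K hkn

end Schubert

/-! ### The bounding box of the snake graph -/

theorem snakeTiles_col_le (w : List Step) : ∀ e ∈ snakeTiles w, e.2 ≤ w.count Step.R := by
  induction w with
  | nil => simp [snakeTiles]
  | cons s w ih => cases s <;> grind [snakeTiles]

theorem inRectangle_outerShape (w : List Step) :
    InRectangle (w.count Step.U + 1) (w.count Step.R + 1) (outerShape w) := by
  intro c hc
  obtain ⟨e, he, hrow, hcol⟩ := mem_outerShape.1 hc
  exact ⟨Nat.lt_succ_of_le (hrow.trans (snakeTiles_row_le w e he)),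
    Nat.lt_succ_of_le (hcol.trans (snakeTiles_col_le w e he))⟩

theorem inRectangle_outerShape_snakeWord {a : List ℕ} (ha : a ≠ []) (ha_even : Even a.length)
    (ha_pos : ∀ x ∈ a, 0 < x) :
    InRectangle (evenSum a) (a.sum - evenSum a) (outerShape (snakeWord a)) := by
  obtain ⟨hU, hR⟩ := count_snakeWord ha ha_even ha_pos
  rw [← hR, Nat.add_sub_cancel, ← hU]
  exact inRectangle_outerShape _

end QSnake

theorem theorem3p2p1 (a : List ℕ) (ha : a ≠ []) (ha_even : Even a.length) (ha_pos : ∀ x ∈ a, 0 < x)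
    (r s : ℕ) (hrs : (r : ℚ) / (s : ℚ) = QSnake.contFracValue a)
    (R S : Polynomial ℤ) (hcop : IsRelPrime R S) (hS : 0 < S.leadingCoeff)
    (hRS : QSnake.qRational a =
      algebraMap (Polynomial ℤ) (RatFunc ℤ) R / algebraMap (Polynomial ℤ) (RatFunc ℤ) S)
    (μ Λ : YoungDiagram) (hμ : μ = QSnake.innerShape (QSnake.snakeWord a))
    (hΛ : Λ = QSnake.outerShape (QSnake.snakeWord a))
    (n k : ℕ) (hn : n = a.sum) (hk : k = QSnake.evenSum a)
    (K : Type*) [Field K] [Fintype K] (q : ℕ) (hq : q = Fintype.card K) :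
    (q : ℤ) ^ μ.card * R.eval (q : ℤ) =
      ((⋃ ν ∈ Set.Icc μ Λ, QSnake.openSchubertCell K k n ν).ncard : ℤ) := by
  subst hμ hΛ hn hk hq
  have hbox := QSnake.inRectangle_outerShape_snakeWord ha ha_even ha_pos
  rw [hbox.ncard_biUnion_openSchubertCell K (QSnake.evenSum_le_sum a),
    QSnake.finsum_mem_Icc_innerShape_outerShape,
    QSnake.numerator_qRational_eq ha ha_even ha_pos hcop hS hRS, QSnake.eval_fst_wordPair]
  push_cast
  rfl
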